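/- Let $r>0$ and let $S^2(r)=\{x\in\mathbb{R}^3:|x|=r\}$, with poles $(0,0,r)$ and $(0,0,-r)$. For $\theta\in[0,\pi]$ let $C_\theta$ be the meridian circle of $S^2(r)$ through both poles with normal $\nu_\theta=(\cos\theta,\sin\theta,0)$, that is, $$C_\theta=\{x\in S^2(r): \langle x,\nu_\theta\rangle=0\}.$$ Let $K\subset\mathbb{R}^3$ be a bounded Borel set that contains a translated copy of every $C_\theta$: for every $\theta\in[0,\pi]$ there is a vector $v\in\mathbb{R}^3$ (which may depend on $\theta$) such that $v+C_\theta\subset K$. Then the Hausdorff dimension of $K$ satisfies $$\dim_H K\ge 2.$$ -/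

import Mathlib

/-- The horizontal unit vector `(cos θ, sin θ, 0)` of `ℝ³`. -/
noncomputable def meridianNormal (θ : ℝ) : EuclideanSpace ℝ (Fin 3) :=
  !₂[Real.cos θ, Real.sin θ, 0]

/-- The meridian circle with normal `(cos θ, sin θ, 0)` of the sphere of radius `r` about the
origin: the (full) great circle through the poles `(0, 0, r)` and `(0, 0, -r)` in which the sphere
meets the plane through the origin orthogonal to that normal. -/
def meridian (r θ : ℝ) : Set (EuclideanSpace ℝ (Fin 3)) :=
  {x | x ∈ Metric.sphere (0 : EuclideanSpace ℝ (Fin 3)) r ∧ inner ℝ (meridianNormal θ) x = 0}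

open MeasureTheory Set
open scoped ENNReal NNReal

/-! Seen from above, each meridian circle is a segment of length `2 * r`, and every horizontal
direction occurs. So the vertical projection of `K`, which is 1-Lipschitz, contains a planar Kakeya
set, and Davies' theorem `two_le_dimH_of_forall_slope` applies.

That theorem is proved by Córdoba's L² argument. If the dimension is below 2, the set is covered by
few grid cells at each dyadic scale `k` (`exists_gridCell_cover_of_hausdorffMeasure_eq_zero`).
Pigeonholing twice finds one scale whose cells capture a sizeable part of the segments for a
sizeable set of slopes. Since segments of different slopes overlap little, this needs about `4 ^ k`
cells, up to small losses (`card_gridCell_lower_bound`), which is too many. -/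

/-! ### Pigeonholing and dyadic covers -/

theorem exists_le_measure_of_le_measure_iUnion {α : Type*} [MeasurableSpace α] (μ : Measure α)
    {q L : ℝ} (hq0 : 0 < q) (hq1 : q < 1) (hL : 0 < L) (X : ℕ → Set α)
    (hX : ENNReal.ofReal L ≤ μ (⋃ k, X k)) :
    ∃ k, ENNReal.ofReal (L * ((1 - q) / 2) * q ^ k) ≤ μ (X k) := by
  by_contra! h
  -- The weights add up to half of `L`, so the pieces cannot all lie below them. Subadditivity
  -- suffices, so no measurability is needed.
  have hs : HasSum (fun k : ℕ => L * ((1 - q) / 2) * q ^ k) (L / 2) := by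
    have := (hasSum_geometric_of_lt_one hq0.le hq1).mul_left (L * ((1 - q) / 2))
    have hq : 1 - q ≠ 0 := by linarith
    rwa [show L * ((1 - q) / 2) * (1 - q)⁻¹ = L / 2 by field_simp] at this
  have hc : 0 < L * ((1 - q) / 2) := mul_pos hL (by linarith)
  have : μ (⋃ k, X k) ≤ ENNReal.ofReal (L / 2) := by
    calc μ (⋃ k, X k) ≤ ∑' k, μ (X k) := measure_iUnion_le _
      _ ≤ ∑' k, ENNReal.ofReal (L * ((1 - q) / 2) * q ^ k) :=
        ENNReal.tsum_le_tsum fun k => (h k).le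
      _ = ENNReal.ofReal (L / 2) := by
        rw [← hs.tsum_eq, ENNReal.ofReal_tsum_of_nonneg (fun k => by positivity) hs.summable]
  have h2 := (ENNReal.ofReal_le_ofReal_iff (by linarith)).1 (hX.trans this)
  linarith

/-- The index of the cell containing `z` in the square grid of mesh `R⁻¹`. -/
noncomputable def gridCell (R : ℝ) (z : ℝ × ℝ) : ℤ × ℤ := (⌊R * z.1⌋, ⌊R * z.2⌋)

theorem abs_floor_sub_floor_le_one {R x y : ℝ} (hR : 0 < R) (h : |x - y| ≤ R⁻¹) :
    ⌊R * x⌋ ∈ Finset.Icc (⌊R * y⌋ - 1) (⌊R * y⌋ + 1) := by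
  have h1 : |R * x - R * y| ≤ 1 := by
    rw [← mul_sub, abs_mul, abs_of_pos hR]
    calc R * |x - y| ≤ R * R⁻¹ := by gcongr
      _ = 1 := mul_inv_cancel₀ hR.ne'
  rw [abs_le] at h1
  rw [Finset.mem_Icc]
  constructor
  · rw [Int.le_floor]; push_cast; linarith [Int.floor_le (R * y)]
  · rw [← Int.lt_add_one_iff, Int.floor_lt]; push_cast; linarith [Int.lt_floor_add_one (R * y)]

theorem exists_gridCells_of_ediam_le {R : ℝ} (hR : 0 < R) (U : Set (ℝ × ℝ))
    (hU : Metric.ediam U ≤ ENNReal.ofReal R⁻¹) :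
    ∃ G : Finset (ℤ × ℤ), G.card ≤ 9 ∧ ∀ z ∈ U, gridCell R z ∈ G := by
  rcases U.eq_empty_or_nonempty with rfl | ⟨w, hw⟩
  · exact ⟨∅, by simp, by simp⟩
  refine ⟨Finset.Icc (⌊R * w.1⌋ - 1) (⌊R * w.1⌋ + 1) ×ˢ Finset.Icc (⌊R * w.2⌋ - 1) (⌊R * w.2⌋ + 1),
    ?_, fun z hz => ?_⟩
  · rw [Finset.card_product, Int.card_Icc, Int.card_Icc]
    ring_nf
    simp
  · have hd : dist z w ≤ R⁻¹ := by
      rw [dist_edist]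
      exact ENNReal.toReal_le_of_le_ofReal (by positivity)
        ((Metric.edist_le_ediam_of_mem hz hw).trans hU)
    rw [Prod.dist_eq, max_le_iff, Real.dist_eq, Real.dist_eq] at hd
    exact Finset.mk_mem_product (abs_floor_sub_floor_le_one hR hd.1)
      (abs_floor_sub_floor_le_one hR hd.2)

/-- Take a cover whose `s`-sum is below 1. A set of diameter above `2⁻¹ ^ (k + 1)` contributes more
than `(2⁻¹ ^ (k + 1)) ^ s`, which limits how many belong to scale `k`. -/
theorem exists_dyadic_cover_of_hausdorffMeasure_eq_zero {E : Type*} [EMetricSpace E]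
    [MeasurableSpace E] [BorelSpace E] {A : Set E} {s : ℝ} (hs : 0 ≤ s)
    (hA : μH[s] A = 0) (m : ℕ) :
    ∃ (t : ℕ → Set E) (κ : ℕ → ℕ), A ⊆ ⋃ n, t n ∧ (∀ n, m ≤ κ n) ∧
      (∀ n, Metric.ediam (t n) ≤ (2⁻¹ : ℝ≥0∞) ^ κ n) ∧
      ∀ k, ∃ J : Finset ℕ, (∀ n, κ n = k → n ∈ J) ∧ (J.card : ℝ) ≤ 2 * ((2 : ℝ) ^ s) ^ (k + 1) := by
  classical
  rw [Measure.hausdorffMeasure_apply] at hA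
  have h0 : (⨅ (t : ℕ → Set E) (_ : A ⊆ ⋃ n, t n)
      (_ : ∀ n, Metric.ediam (t n) ≤ (2⁻¹ : ℝ≥0∞) ^ m),
      ∑' n, ⨆ _ : (t n).Nonempty, Metric.ediam (t n) ^ s) < 1 := by
    refine lt_of_le_of_lt ?_ zero_lt_one
    rw [← hA]
    exact le_iSup₂_of_le (f := fun (r : ℝ≥0∞) (_ : 0 < r) => ⨅ (t : ℕ → Set E)
      (_ : A ⊆ ⋃ n, t n) (_ : ∀ n, Metric.ediam (t n) ≤ r),
      ∑' n, ⨆ _ : (t n).Nonempty, Metric.ediam (t n) ^ s) ((2⁻¹ : ℝ≥0∞) ^ m)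
      (ENNReal.pow_pos (by simp) m) le_rfl
  simp only [iInf_lt_iff] at h0
  obtain ⟨t, hAt, hm, hsum⟩ := h0
  -- The cap `n + m` gives sets of diameter zero a finite scale. It is attained at scale `k` by at
  -- most the index `k - m`, inserted by hand below.
  let κ : ℕ → ℕ := fun n =>
    Nat.findGreatest (fun k => Metric.ediam (t n) ≤ (2⁻¹ : ℝ≥0∞) ^ k) (n + m)
  refine ⟨t, κ, hAt, fun n => Nat.le_findGreatest (by omega) (hm n),
    fun n => Nat.findGreatest_spec (P := fun k => Metric.ediam (t n) ≤ (2⁻¹ : ℝ≥0∞) ^ k)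
      (Nat.le_add_left m n) (hm n), fun k => ?_⟩
  set a : ℝ≥0∞ := ((2⁻¹ : ℝ≥0∞) ^ (k + 1)) ^ s with ha
  have ha' : a = ENNReal.ofReal (((2 : ℝ) ^ s) ^ (k + 1))⁻¹ := by
    rw [ha, ENNReal.ofReal_inv_of_pos (by positivity), ← Real.rpow_natCast, ← Real.rpow_mul
      (by norm_num), mul_comm, Real.rpow_mul (by norm_num), Real.rpow_natCast,
      ← ENNReal.ofReal_rpow_of_pos (by positivity), ENNReal.ofReal_pow (by norm_num),
      ← ENNReal.inv_rpow, ENNReal.inv_pow]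
    simp
  have hapos : a ≠ 0 := by
    rw [ha']; simp; positivity
  set f : ℕ → ℝ≥0∞ := fun n => ⨆ _ : (t n).Nonempty, Metric.ediam (t n) ^ s with hf
  have hfin : {n | a ≤ f n}.Finite :=
    ENNReal.finite_const_le_of_tsum_ne_top (hsum.trans ENNReal.one_lt_top).ne hapos
  refine ⟨insert (k - m) hfin.toFinset, fun n hn => ?_, ?_⟩
  · rw [Finset.mem_insert, Set.Finite.mem_toFinset, mem_ofPred_eq]
    by_cases h : n + m = k
    · left; omega
    right
    have hle : k ≤ n + m := hn ▸ Nat.findGreatest_le _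
    have hlt : ¬ Metric.ediam (t n) ≤ (2⁻¹ : ℝ≥0∞) ^ (k + 1) :=
      Nat.findGreatest_is_greatest (P := fun k => Metric.ediam (t n) ≤ (2⁻¹ : ℝ≥0∞) ^ k)
        (n := n + m) (by change κ n < k + 1; omega) (by omega)
    have hne : (t n).Nonempty := by
      by_contra h
      rw [Set.not_nonempty_iff_eq_empty] at h
      simp [h] at hlt
    rw [hf]
    simp only [hne, iSup_pos]
    exact ENNReal.rpow_le_rpow (not_le.1 hlt).le hs
  · have h0 : ((insert (k - m) hfin.toFinset).card : ℝ) ≤ hfin.toFinset.card + 1 := by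
      exact_mod_cast Finset.card_insert_le _ _
    have h1 : (hfin.toFinset.card : ℝ≥0∞) * a ≤ 1 := by
      calc (hfin.toFinset.card : ℝ≥0∞) * a = ∑ _n ∈ hfin.toFinset, a := by simp
        _ ≤ ∑ n ∈ hfin.toFinset, f n := Finset.sum_le_sum fun n hn => by simpa using hn
        _ ≤ ∑' n, f n := ENNReal.sum_le_tsum _
        _ ≤ 1 := hsum.le
    generalize hfin.toFinset.card = M at h1 h0
    have h2 : (M : ℝ) * (((2 : ℝ) ^ s) ^ (k + 1))⁻¹ ≤ 1 := by
      rw [ha', ← ENNReal.ofReal_natCast, ← ENNReal.ofReal_mul (by positivity),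
        ENNReal.ofReal_le_one] at h1
      exact h1
    rw [← div_eq_mul_inv, div_le_one (by positivity)] at h2
    have h3 : (1 : ℝ) ≤ ((2 : ℝ) ^ s) ^ (k + 1) :=
      one_le_pow₀ (Real.one_le_rpow (by norm_num) hs)
    linarith

theorem exists_gridCell_cover_of_hausdorffMeasure_eq_zero {A : Set (ℝ × ℝ)} {s : ℝ} (hs : 0 ≤ s)
    (hA : μH[s] A = 0) (m : ℕ) :
    ∃ G : ℕ → Finset (ℤ × ℤ), (∀ k < m, G k = ∅) ∧
      (∀ k, ((G k).card : ℝ) ≤ 18 * ((2 : ℝ) ^ s) ^ (k + 1)) ∧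
      ∀ z ∈ A, ∃ k, gridCell (2 ^ k) z ∈ G k := by
  classical
  obtain ⟨t, κ, hAt, hm, hd, hJ⟩ := exists_dyadic_cover_of_hausdorffMeasure_eq_zero hs hA m
  choose J hJ hJcard using hJ
  have hU : ∀ n, ∃ G : Finset (ℤ × ℤ), G.card ≤ 9 ∧ ∀ z ∈ t n, gridCell (2 ^ κ n) z ∈ G := by
    intro n
    refine exists_gridCells_of_ediam_le (by positivity) _ ((hd n).trans_eq ?_)
    rw [ENNReal.ofReal_inv_of_pos (by positivity), ENNReal.ofReal_pow (by norm_num),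
      ENNReal.inv_pow]
    simp
  choose H hHcard hH using hU
  refine ⟨fun k => if m ≤ k then (J k).biUnion H else ∅, fun k hk => if_neg (by omega),
    fun k => ?_, fun z hz => ?_⟩
  · have : (((J k).biUnion H).card : ℝ) ≤ (J k).card * 9 := by
      exact_mod_cast Finset.card_biUnion_le_card_mul _ _ _ fun n _ => hHcard n
    dsimp only
    split_ifs
    · linarith [hJcard k]
    · simp; positivity
  · obtain ⟨n, hn⟩ := mem_iUnion.1 (hAt hz)
    refine ⟨κ n, ?_⟩
    dsimp only
    rw [if_pos (hm n)]
    exact Finset.mem_biUnion.2 ⟨n, hJ _ n rfl, hH n z hn⟩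

/-! ### Córdoba's L² estimate -/

theorem sum_inv_dist_add_one_le (j k : ℕ) (hj : j < 2 ^ k) :
    ∑ i ∈ Finset.range (2 ^ k), ((Nat.dist i j : ℝ) + 1)⁻¹ ≤ 2 * (k + 1) := by
  have hmaps : ∀ i ∈ Finset.range (2 ^ k), Nat.dist i j ∈ Finset.range (2 ^ k) := by
    intro i hi
    rw [Finset.mem_range] at *
    unfold Nat.dist; omega
  rw [← Finset.sum_fiberwise_of_maps_to hmaps]
  have hh : ∑ d ∈ Finset.range (2 ^ k), ((d : ℝ) + 1)⁻¹ ≤ k + 1 := by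
    have h1 := harmonic_le_one_add_log (2 ^ k)
    have h2 : ((harmonic (2 ^ k) : ℚ) : ℝ) = ∑ d ∈ Finset.range (2 ^ k), ((d : ℝ) + 1)⁻¹ := by
      simp [harmonic]
    rw [h2] at h1
    push_cast at h1
    rw [Real.log_pow] at h1
    have h3 : Real.log 2 ≤ 1 := by linarith [Real.log_two_lt_d9]
    nlinarith [Nat.cast_nonneg (α := ℝ) k]
  calc _ ≤ ∑ d ∈ Finset.range (2 ^ k), 2 * ((d : ℝ) + 1)⁻¹ := by
        refine Finset.sum_le_sum fun d _ => ?_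
        have hc : (({i ∈ Finset.range (2 ^ k) | Nat.dist i j = d}).card : ℝ) ≤ 2 := by
          have : (Finset.range (2 ^ k)).filter (fun i => Nat.dist i j = d) ⊆ {j - d, j + d} := by
            intro i hi
            have hi : i - j + (j - i) = d := (Finset.mem_filter.1 hi).2
            simp only [Finset.mem_insert, Finset.mem_singleton]
            omega
          exact_mod_cast (Finset.card_le_card this).trans Finset.card_le_two
        calc _ = ∑ i ∈ Finset.range (2 ^ k) with Nat.dist i j = d, ((d : ℝ) + 1)⁻¹ := by
              refine Finset.sum_congr rfl fun i hi => ?_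
              rw [(Finset.mem_filter.1 hi).2]
          _ ≤ _ := by
              rw [Finset.sum_const, nsmul_eq_mul]
              gcongr
    _ ≤ 2 * (k + 1) := by rw [← Finset.mul_sum]; gcongr

theorem volume_real_abs_affine_le (σ b w : ℝ) (hw : 0 ≤ w) (T : Set ℝ)
    (hT : ∀ x ∈ T, |σ * x + b| ≤ w) : |σ| * volume.real T ≤ 2 * w := by
  rcases eq_or_ne σ 0 with rfl | hσ
  · simpa using hw
  have hpos := abs_pos.2 hσ
  have hsub : T ⊆ Metric.closedBall (-b / σ) (w / |σ|) := by
    intro x hx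
    rw [Metric.mem_closedBall, Real.dist_eq, le_div_iff₀ hpos, ← abs_mul]
    rw [show (x - -b / σ) * σ = σ * x + b by field_simp; ring]
    exact hT x hx
  have h := measureReal_mono (μ := volume) hsub measure_closedBall_lt_top.ne
  rw [Real.volume_real_closedBall (by positivity)] at h
  calc |σ| * volume.real T ≤ |σ| * (2 * (w / |σ|)) := by gcongr
    _ = 2 * w := by field_simp

theorem measurable_gridCell (R : ℝ) : Measurable (gridCell R) := by
  unfold gridCell
  fun_prop

/-- Cauchy–Schwarz over the cells. Within one cell a line has abscissae in an interval of length
`R⁻¹`, whence that factor; and as slopes are at most 1, two lines meeting the same cell differ in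
height there by at most `2 * R⁻¹`. -/
theorem sq_sum_volume_le {ι : Type*} (F : Finset ι) {R : ℝ} (hR : 0 < R) (ℓ : ℝ) (σ b a : ι → ℝ)
    (hσ : ∀ i ∈ F, σ i ∈ Icc (0 : ℝ) 1) (G : Finset (ℤ × ℤ)) :
    (∑ i ∈ F, volume.real {x ∈ Icc (a i) (a i + ℓ) | gridCell R (x, σ i * x + b i) ∈ G}) ^ 2 ≤
      G.card * (R⁻¹ * ∑ i ∈ F, ∑ j ∈ F, volume.real
        {x ∈ Icc (a j) (a j + ℓ) | |(σ i - σ j) * x + (b i - b j)| ≤ 2 * R⁻¹}) := by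
  classical
  let Y : ι → ℤ × ℤ → Set ℝ := fun i g =>
    {x | x ∈ Icc (a i) (a i + ℓ) ∧ gridCell R (x, σ i * x + b i) = g}
  have hYm : ∀ i g, MeasurableSet (Y i g) := fun i g => by
    refine measurableSet_Icc.inter ?_
    exact measurableSet_eq_fun ((measurable_gridCell R).comp (by fun_prop)) measurable_const
  have hYfin : ∀ i g, volume (Y i g) ≠ ∞ := fun i g =>
    measure_ne_top_of_subset (fun x hx => hx.1) (by simp : volume (Icc (a i) (a i + ℓ)) ≠ ∞)
  have hYd : ∀ i, Pairwise (Function.onFun Disjoint (Y i)) := by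
    intro i g g' hgg
    rw [Function.onFun, Set.disjoint_left]
    rintro x ⟨_, h⟩ ⟨_, h'⟩
    exact hgg (h.symm.trans h')
  have hYsum : ∀ i (H : Finset (ℤ × ℤ)), volume.real (⋃ g ∈ H, Y i g) =
      ∑ g ∈ H, volume.real (Y i g) := fun i H =>
    measureReal_biUnion_finset (fun g _ g' _ h => hYd i h) (fun g _ => hYm i g)
      (fun g _ => hYfin i g)
  have hfl : ∀ u v : ℝ, ⌊R * u⌋ = ⌊R * v⌋ → |u - v| ≤ R⁻¹ := by
    intro u v h
    have := Int.abs_sub_lt_one_of_floor_eq_floor h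
    rw [← mul_sub, abs_mul, abs_of_pos hR] at this
    rw [← one_div, le_div_iff₀ hR]
    linarith
  have hYle : ∀ i g, volume.real (Y i g) ≤ R⁻¹ := by
    intro i g
    have hsub : Y i g ⊆ Icc (g.1 * R⁻¹) (g.1 * R⁻¹ + R⁻¹) := by
      rintro x ⟨_, hx⟩
      have h1 : ⌊R * x⌋ = g.1 := congrArg Prod.fst hx
      rw [Int.floor_eq_iff] at h1
      rw [mem_Icc, ← div_eq_mul_inv, ← one_div, ← add_div, div_le_iff₀ hR, le_div_iff₀ hR]
      constructor <;> linarith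
    have h := measureReal_mono (μ := volume) hsub (by simp)
    rwa [Real.volume_real_Icc, add_sub_cancel_left, max_eq_left (by positivity)] at h
  have hleft : ∀ i, volume.real {x ∈ Icc (a i) (a i + ℓ) | gridCell R (x, σ i * x + b i) ∈ G} =
      ∑ g ∈ G, volume.real (Y i g) := by
    intro i
    rw [← hYsum]
    congr 1
    ext x
    simp [Y]
  have hpair : ∀ i ∈ F, ∀ j ∈ F, ∑ g ∈ G, volume.real (Y i g) * volume.real (Y j g) ≤
      R⁻¹ * volume.real
        {x ∈ Icc (a j) (a j + ℓ) | |(σ i - σ j) * x + (b i - b j)| ≤ 2 * R⁻¹} := by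
    intro i hi j hj
    calc _ ≤ ∑ g ∈ G with (Y i g).Nonempty, R⁻¹ * volume.real (Y j g) := by
          rw [Finset.sum_filter]
          refine Finset.sum_le_sum fun g _ => ?_
          split_ifs with h
          · gcongr
            exact hYle i g
          · rw [Set.not_nonempty_iff_eq_empty] at h
            simp [h]
      _ = R⁻¹ * volume.real (⋃ g ∈ G.filter fun g => (Y i g).Nonempty, Y j g) := by
          rw [← Finset.mul_sum, hYsum]
      _ ≤ _ := by
          refine mul_le_mul_of_nonneg_left (measureReal_mono ?_ ?_) (by positivity)
          · intro x hx
            simp only [mem_iUnion, Finset.mem_filter] at hx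
            obtain ⟨g, ⟨_, x', _, hx'⟩, hx, hxg⟩ := hx
            refine ⟨hx, ?_⟩
            rw [← hxg] at hx'
            have h1 : |x - x'| ≤ R⁻¹ := hfl _ _ (congrArg Prod.fst hx').symm
            have h2 : |(σ i * x' + b i) - (σ j * x + b j)| ≤ R⁻¹ :=
              hfl _ _ (congrArg Prod.snd hx')
            have h3 : |σ i * (x - x')| ≤ R⁻¹ := by
              rw [abs_mul, abs_of_nonneg (hσ i hi).1]
              exact (mul_le_of_le_one_left (abs_nonneg _) (hσ i hi).2).trans h1
            calc _ = |σ i * (x - x') + ((σ i * x' + b i) - (σ j * x + b j))| := by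
                  congr 1; ring
              _ ≤ _ := (abs_add_le _ _).trans (by linarith)
          · exact measure_ne_top_of_subset (fun x hx => hx.1)
              (by simp : volume (Icc (a j) (a j + ℓ)) ≠ ∞)
  simp only [hleft]
  rw [Finset.sum_comm]
  refine sq_sum_le_card_mul_sum_sq.trans ?_
  refine mul_le_mul_of_nonneg_left ?_ (by positivity)
  calc _ = ∑ i ∈ F, ∑ j ∈ F, ∑ g ∈ G, volume.real (Y i g) * volume.real (Y j g) := by
        simp only [sq, Finset.sum_mul_sum]
        rw [Finset.sum_comm]
        refine Finset.sum_congr rfl fun i _ => Finset.sum_comm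
    _ ≤ ∑ i ∈ F, ∑ j ∈ F, _ := Finset.sum_le_sum fun i hi => Finset.sum_le_sum (hpair i hi)
    _ = _ := by simp only [Finset.mul_sum]

/-- Two segments whose slopes lie in the bins `i` and `j` of width `R⁻¹`
overlap little at scale `R⁻¹`. -/
theorem volume_real_overlap_le {R ℓ σ τ b c a : ℝ} (hR : 0 < R) (hℓ : 0 ≤ ℓ) {i j : ℕ}
    (hσ : 0 ≤ σ) (hτ : 0 ≤ τ) (hi : ⌊R * σ⌋₊ = i) (hj : ⌊R * τ⌋₊ = j) :
    volume.real {x ∈ Icc a (a + ℓ) | |(σ - τ) * x + (b - c)| ≤ 2 * R⁻¹} ≤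
      (2 * ℓ + 12) * ((Nat.dist i j : ℝ) + 1)⁻¹ := by
  set T := {x ∈ Icc a (a + ℓ) | |(σ - τ) * x + (b - c)| ≤ 2 * R⁻¹}
  have h1 : volume.real T ≤ ℓ := by
    have h := measureReal_mono (μ := volume) (fun x hx => hx.1 : T ⊆ Icc a (a + ℓ)) (by simp)
    rwa [Real.volume_real_Icc, add_sub_cancel_left, max_eq_left hℓ] at h
  have h2 := volume_real_abs_affine_le (σ - τ) (b - c) (2 * R⁻¹) (by positivity) T
    (fun x hx => hx.2)
  have h0 : 0 ≤ volume.real T := measureReal_nonneg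
  rw [← div_eq_mul_inv, le_div_iff₀ (by positivity)]
  have hd : (Nat.dist i j : ℝ) - 1 ≤ R * |σ - τ| := by
    have hi1 := Nat.floor_le (mul_nonneg hR.le hσ)
    have hi2 := Nat.lt_floor_add_one (R * σ)
    have hj1 := Nat.floor_le (mul_nonneg hR.le hτ)
    have hj2 := Nat.lt_floor_add_one (R * τ)
    rw [hi] at hi1 hi2
    rw [hj] at hj1 hj2
    rw [show R * |σ - τ| = |R * σ - R * τ| by rw [← mul_sub, abs_mul, abs_of_pos hR]]
    rcases le_total i j with h | h
    · rw [Nat.dist_eq_sub_of_le h, Nat.cast_sub h]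
      linarith [neg_le_abs (R * σ - R * τ)]
    · rw [Nat.dist_comm, Nat.dist_eq_sub_of_le h, Nat.cast_sub h]
      linarith [le_abs_self (R * σ - R * τ)]
  have h3 : volume.real T * ((Nat.dist i j : ℝ) - 1) ≤ 4 := by
    calc _ ≤ volume.real T * (R * |σ - τ|) := by gcongr
      _ = R * (|σ - τ| * volume.real T) := by ring
      _ ≤ R * (2 * (2 * R⁻¹)) := by gcongr
      _ = 4 := by field_simp; norm_num
  -- For equal or adjacent bins the trivial bound `ℓ` is used; otherwise `d + 1 ≤ 3 * (d - 1)` turns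
  -- 4 into 12.
  rcases le_or_gt (Nat.dist i j) 1 with h | h
  · have : (Nat.dist i j : ℝ) ≤ 1 := by exact_mod_cast h
    nlinarith
  · have : (2 : ℝ) ≤ Nat.dist i j := by exact_mod_cast h
    nlinarith

/-- Lower bound for the number of cells of the dyadic grid of mesh `2⁻ᵏ` that meet segments of many
slopes in large sets. -/
theorem card_gridCell_lower_bound {S : Set ℝ} (hS : S ⊆ Ico 0 1) {a b : ℝ → ℝ} {ℓ α β : ℝ}
    (hℓ : 0 ≤ ℓ) (hα : 0 ≤ α) (hβ : 0 < β) (k : ℕ) (hSβ : ENNReal.ofReal β ≤ volume S)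
    (G : Finset (ℤ × ℤ))
    (hG : ∀ σ ∈ S, α ≤
      volume.real {x ∈ Icc (a σ) (a σ + ℓ) | gridCell (2 ^ k) (x, σ * x + b σ) ∈ G}) :
    β * 4 ^ k * α ^ 2 ≤ G.card * ((2 * ℓ + 12) * (2 * (k + 1))) := by
  classical
  set R : ℝ := 2 ^ k with hRdef
  have hR : 0 < R := by positivity
  -- One slope is kept per occupied bin of width `R⁻¹`. The bins cover `S`, so its outer measure
  -- bounds their number from below.
  let F : Finset ℕ := {i ∈ Finset.range (2 ^ k) | ∃ σ ∈ S, ⌊R * σ⌋₊ = i}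
  have hF : ∀ i, ∃ σ, i ∈ F → σ ∈ S ∧ ⌊R * σ⌋₊ = i := by
    intro i
    by_cases h : i ∈ F
    · obtain ⟨σ, hσ⟩ := (Finset.mem_filter.1 h).2
      exact ⟨σ, fun _ => hσ⟩
    · exact ⟨0, fun h' => absurd h' h⟩
  choose σ hσ using hF
  have hσI : ∀ i ∈ F, σ i ∈ Icc (0 : ℝ) 1 := fun i hi => Ico_subset_Icc_self (hS (hσ i hi).1)
  have hcard : β * R ≤ F.card := by
    have hsub : S ⊆ ⋃ i ∈ F, Icc (i * R⁻¹) (i * R⁻¹ + R⁻¹) := by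
      intro τ hτ
      have h01 := hS hτ
      have h1 := Nat.floor_le (mul_nonneg hR.le h01.1)
      have h2 := Nat.lt_floor_add_one (R * τ)
      refine mem_biUnion (x := ⌊R * τ⌋₊) ?_ ?_
      · refine Finset.mem_filter.2 ⟨Finset.mem_range.2 ?_, τ, hτ, rfl⟩
        rw [Nat.floor_lt (mul_nonneg hR.le h01.1)]
        push_cast
        exact mul_lt_of_lt_one_right hR h01.2
      · rw [mem_Icc, ← div_eq_mul_inv, ← one_div, ← add_div, div_le_iff₀ hR, le_div_iff₀ hR]
        constructor <;> linarith
    have h := hSβ.trans ((measure_mono hsub).trans (measure_biUnion_finset_le _ _))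
    simp only [Real.volume_Icc, add_sub_cancel_left, Finset.sum_const, nsmul_eq_mul] at h
    rw [← ENNReal.ofReal_natCast, ← ENNReal.ofReal_mul (by positivity),
      ENNReal.ofReal_le_ofReal_iff (by positivity), ← div_eq_mul_inv, le_div_iff₀ hR] at h
    exact h
  have hNpos : (0 : ℝ) < F.card := (mul_pos hβ hR).trans_le hcard
  have hlow : F.card * α ≤ ∑ i ∈ F, volume.real
      {x ∈ Icc (a (σ i)) (a (σ i) + ℓ) | gridCell R (x, σ i * x + b (σ i)) ∈ G} := by
    rw [← nsmul_eq_mul]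
    exact Finset.card_nsmul_le_sum _ _ _ fun i hi => hG _ (hσ i hi).1
  have hup : ∑ i ∈ F, ∑ j ∈ F, volume.real {x ∈ Icc (a (σ j)) (a (σ j) + ℓ) |
      |(σ i - σ j) * x + (b (σ i) - b (σ j))| ≤ 2 * R⁻¹} ≤
      F.card * ((2 * ℓ + 12) * (2 * (k + 1))) := by
    rw [Finset.sum_comm, ← nsmul_eq_mul]
    refine Finset.sum_le_card_nsmul _ _ _ fun j hj => ?_
    calc _ ≤ ∑ i ∈ F, (2 * ℓ + 12) * ((Nat.dist i j : ℝ) + 1)⁻¹ :=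
          Finset.sum_le_sum fun i hi => volume_real_overlap_le hR hℓ (hσI i hi).1 (hσI j hj).1
            (hσ i hi).2 (hσ j hj).2
      _ ≤ ∑ i ∈ Finset.range (2 ^ k), (2 * ℓ + 12) * ((Nat.dist i j : ℝ) + 1)⁻¹ :=
          Finset.sum_le_sum_of_subset_of_nonneg (Finset.filter_subset _ _)
            fun i _ _ => by positivity
      _ ≤ _ := by
          rw [← Finset.mul_sum]
          gcongr
          exact sum_inv_dist_add_one_le j k (Finset.mem_range.1 (Finset.mem_filter.1 hj).1)
  have hcs := sq_sum_volume_le F hR ℓ σ (fun i => b (σ i)) (fun i => a (σ i)) hσI G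
  have h1 : (F.card * α) ^ 2 ≤ G.card * (R⁻¹ * (F.card * ((2 * ℓ + 12) * (2 * (k + 1))))) := by
    refine (pow_le_pow_left₀ (by positivity) hlow 2).trans (hcs.trans ?_)
    gcongr
  have h2 : F.card * α ^ 2 * R ≤ G.card * ((2 * ℓ + 12) * (2 * (k + 1))) := by
    refine le_of_mul_le_mul_left ?_ hNpos
    calc _ = (F.card * α) ^ 2 * R := by ring
      _ ≤ G.card * (R⁻¹ * (F.card * ((2 * ℓ + 12) * (2 * (k + 1))))) * R := by gcongr
      _ = _ := by field_simp
  calc β * 4 ^ k * α ^ 2 = β * R * α ^ 2 * R := by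
        rw [show (4 : ℝ) ^ k = R * R by rw [hRdef, ← mul_pow]; norm_num]; ring
    _ ≤ F.card * α ^ 2 * R := by gcongr
    _ ≤ _ := h2

/-! ### Davies' theorem in the plane -/

/-- **Davies' theorem**: a planar set that contains a segment of every slope in `[0, 1)`
has Hausdorff dimension at least two. -/
theorem two_le_dimH_of_forall_slope {A : Set (ℝ × ℝ)} {ℓ : ℝ} (hℓ : 0 < ℓ)
    (hA : ∀ σ ∈ Ico (0 : ℝ) 1, ∃ a b : ℝ, ∀ x ∈ Icc a (a + ℓ), (x, σ * x + b) ∈ A) :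
    2 ≤ dimH A := by
  by_contra! hlt
  obtain ⟨s, hs, hs2⟩ := ENNReal.lt_iff_exists_nnreal_btwn.1 hlt
  have hs2 : (s : ℝ) < 2 := by exact_mod_cast hs2
  have hμ := hausdorffMeasure_of_dimH_lt hs
  -- Pigeonholing costs `q ^ (3 * k)`: one factor for the slopes, two for the squared length. As `4
  -- * q ^ 4 = 2 ^ s`, a factor `q ^ k` is left to beat `k + 1`.
  set q : ℝ := 2 ^ (((s : ℝ) - 2) / 4) with hq
  have hq0 : 0 < q := by positivity
  have hq1 : q < 1 := Real.rpow_lt_one_of_one_lt_of_neg (by norm_num) (by linarith)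
  have hq4 : 4 * q ^ 4 = 2 ^ (s : ℝ) := by
    rw [hq, ← Real.rpow_natCast, ← Real.rpow_mul (by norm_num)]
    push_cast
    rw [div_mul_cancel₀ _ (by norm_num), Real.rpow_sub (by norm_num)]
    norm_num
    ring
  set c : ℝ := (1 - q) / 2 with hc
  have hc0 : 0 < c := by rw [hc]; linarith
  set D : ℝ := 18 * 2 ^ (s : ℝ) * ((2 * ℓ + 12) * 2) with hD
  have hlim : Filter.Tendsto (fun k : ℕ => D * ((k + 1) * q ^ k)) Filter.atTop (nhds 0) := by
    have := ((tendsto_self_mul_const_pow_of_lt_one hq0.le hq1).add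
      (tendsto_pow_atTop_nhds_zero_of_lt_one hq0.le hq1)).const_mul D
    simpa [add_mul] using this
  obtain ⟨m, hm⟩ := Filter.eventually_atTop.1
    (hlim.eventually_lt_const (show 0 < c * (ℓ * c) ^ 2 by positivity))
  obtain ⟨G, hG0, hGcard, hGA⟩ :=
    exists_gridCell_cover_of_hausdorffMeasure_eq_zero s.coe_nonneg hμ m
  have hA' : ∀ σ, ∃ a b : ℝ, σ ∈ Ico (0 : ℝ) 1 → ∀ x ∈ Icc a (a + ℓ), (x, σ * x + b) ∈ A := by
    intro σ
    by_cases h : σ ∈ Ico (0 : ℝ) 1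
    · obtain ⟨a, b, hab⟩ := hA σ h
      exact ⟨a, b, fun _ => hab⟩
    · exact ⟨0, 0, fun h' => absurd h' h⟩
  choose a b hab using hA'
  let X : ℝ → ℕ → Set ℝ := fun σ k =>
    {x ∈ Icc (a σ) (a σ + ℓ) | gridCell (2 ^ k) (x, σ * x + b σ) ∈ G k}
  have hX : ∀ σ ∈ Ico (0 : ℝ) 1, ∃ k, ℓ * c * q ^ k ≤ volume.real (X σ k) := by
    intro σ hσ
    obtain ⟨k, hk⟩ := exists_le_measure_of_le_measure_iUnion volume hq0 hq1 hℓ (X σ) (by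
      calc ENNReal.ofReal ℓ = volume (Icc (a σ) (a σ + ℓ)) := by simp
        _ ≤ _ := measure_mono fun x hx => by
          obtain ⟨k, hk⟩ := hGA _ (hab σ hσ x hx)
          exact mem_iUnion.2 ⟨k, hx, hk⟩)
    refine ⟨k, ?_⟩
    rwa [Measure.real, ← ENNReal.ofReal_le_iff_le_toReal]
    exact measure_ne_top_of_subset (fun x hx => hx.1)
      (by simp : volume (Icc (a σ) (a σ + ℓ)) ≠ ∞)
  -- The good scale depends on the slope; a second pigeonholing, over slopes, fixes one scale.
  obtain ⟨k, hk⟩ := exists_le_measure_of_le_measure_iUnion volume hq0 hq1 one_pos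
    (fun k => {σ ∈ Ico (0 : ℝ) 1 | ℓ * c * q ^ k ≤ volume.real (X σ k)}) (by
      calc ENNReal.ofReal 1 = volume (Ico (0 : ℝ) 1) := by simp
        _ ≤ _ := measure_mono fun σ hσ => by
          obtain ⟨k, hk⟩ := hX σ hσ
          exact mem_iUnion.2 ⟨k, hσ, hk⟩)
  rw [one_mul] at hk
  have key := card_gridCell_lower_bound (fun σ hσ => hσ.1) hℓ.le (α := ℓ * c * q ^ k)
    (by positivity) (by positivity) k hk (G k) (fun σ hσ => hσ.2)
  rcases lt_or_ge k m with hkm | hkm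
  · rw [hG0 k hkm, Finset.card_empty, Nat.cast_zero, zero_mul] at key
    exact absurd key (not_le.2 (by positivity))
  · have h1 : c * q ^ k * 4 ^ k * (ℓ * c * q ^ k) ^ 2 ≤
        18 * ((2 : ℝ) ^ (s : ℝ)) ^ (k + 1) * ((2 * ℓ + 12) * (2 * (k + 1))) := by
      refine key.trans ?_
      gcongr
      exact hGcard k
    have h2 : (4 ^ k * (q ^ k) ^ 3) * (c * (ℓ * c) ^ 2) ≤
        (4 ^ k * (q ^ k) ^ 3) * (D * ((k + 1) * q ^ k)) := by
      calc _ = c * q ^ k * 4 ^ k * (ℓ * c * q ^ k) ^ 2 := by ring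
        _ ≤ _ := h1
        _ = 18 * (2 ^ (s : ℝ) * (4 * q ^ 4) ^ k) * ((2 * ℓ + 12) * (2 * (k + 1))) := by
            rw [hq4]; ring
        _ = _ := by rw [hD, mul_pow, ← pow_mul, ← pow_mul]; ring
    exact absurd (le_of_mul_le_mul_left h2 (by positivity)) (not_le.2 (hm k hkm))

/-! ### Projecting the meridians -/

/-- The map `(x₀, x₁, x₂) ↦ (x₁, -x₀)`. -/
def horizontalProj (x : EuclideanSpace ℝ (Fin 3)) : ℝ × ℝ := (x 1, -x 0)

theorem lipschitzWith_horizontalProj : LipschitzWith 1 horizontalProj := by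
  refine LipschitzWith.of_dist_le_mul fun x y => ?_
  rw [NNReal.coe_one, one_mul, Prod.dist_eq, horizontalProj, horizontalProj, dist_neg_neg,
    dist_eq_norm x y]
  exact max_le (PiLp.norm_apply_le (x - y) 1) (PiLp.norm_apply_le (x - y) 0)
theorem mem_meridian {r θ t : ℝ} (ht : |t| ≤ r) :
    !₂[-(t * Real.sin θ), t * Real.cos θ, Real.sqrt (r ^ 2 - t ^ 2)] ∈ meridian r θ := by
  have hr : 0 ≤ r := (abs_nonneg t).trans ht
  refine ⟨?_, ?_⟩
  · rw [mem_sphere_zero_iff_norm, EuclideanSpace.norm_eq, Real.sqrt_eq_iff_mul_self_eq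
      (by positivity) hr]
    have h := Real.mul_self_sqrt (sub_nonneg.2 (sq_le_sq' (abs_le.1 ht).1 (abs_le.1 ht).2))
    simp only [Fin.sum_univ_three, Real.norm_eq_abs, sq_abs]
    simp
    nlinarith [Real.sin_sq_add_cos_sq θ]
  · simp [meridianNormal, Fin.sum_univ_three, PiLp.inner_apply]
    ring

theorem theorem1 (r : ℝ) (hr : 0 < r) (K : Set (EuclideanSpace ℝ (Fin 3)))
    (hBdd : Bornology.IsBounded K) (hBorel : MeasurableSet K)
    (hK : ∀ θ ∈ Set.Icc (0 : ℝ) Real.pi, ∃ v : EuclideanSpace ℝ (Fin 3),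
      (fun x => v + x) '' meridian r θ ⊆ K) :
    2 ≤ dimH K := by
  have himage : dimH (horizontalProj '' K) ≤ dimH K := lipschitzWith_horizontalProj.dimH_image_le K
  refine le_trans ?_ himage
  refine two_le_dimH_of_forall_slope (half_pos hr) fun σ hσ => ?_
  -- The quarter turn in `horizontalProj` makes the image of the meridian at `θ` have slope `tan θ`.
  obtain ⟨v, hv⟩ := hK (Real.arctan σ) ⟨Real.arctan_nonneg.2 hσ.1,
    (Real.arctan_lt_pi_div_two σ).le.trans (by linarith [Real.pi_pos])⟩
  have hcos : 0 < Real.cos (Real.arctan σ) := Real.cos_arctan_pos σ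
  have hcos2 : 1 / 2 ≤ Real.cos (Real.arctan σ) := by
    rw [Real.cos_arctan]
    refine one_div_le_one_div_of_le (by positivity) (Real.sqrt_le_iff.2 ⟨by norm_num, ?_⟩)
    nlinarith [hσ.1, hσ.2]
  have hsin : Real.sin (Real.arctan σ) = σ * Real.cos (Real.arctan σ) := by
    rw [← Real.tan_mul_cos hcos.ne', Real.tan_arctan]
  set C := Real.cos (Real.arctan σ)
  refine ⟨v 1, -(v 0) - σ * v 1, fun x hx => ?_⟩
  -- Since `C ≥ 1 / 2`, abscissae up to `r / 2` beyond `v 1` keep the parameter within `r`; hence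
  -- the segment length `r / 2`.
  have ht : |(x - v 1) / C| ≤ r := by
    rw [abs_of_nonneg (div_nonneg (by linarith [hx.1]) hcos.le), div_le_iff₀ hcos]
    nlinarith [hx.2]
  refine ⟨_, hv ⟨_, mem_meridian ht, rfl⟩, ?_⟩
  have hC : C ≠ 0 := hcos.ne'
  simp only [horizontalProj, PiLp.add_apply, hsin, Prod.mk.injEq]
  constructor
  · simp; field_simp; ring
  · simp; field_simp; ring
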